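/- Let $K>d\ge 0$ be integers and let $\Phi\in\mathbb R^{K\times d}$ be a feature matrix of rank $d$ with rows $\phi_1^\top,\dots,\phi_K^\top$. For $k\in[K]$ let $$\mathcal R_k=\{\mu\in\mathbb R^K:\mu_k>\mu_i\ \forall i\ne k\},\qquad \Theta_k=\{\theta\in\mathbb R^d:\Phi\theta\in\mathcal R_k\},$$ and let $\mathcal C_k$ (the robust observation region) be the set of $\mu\in\mathcal R_k$ such that for every probability vector $\alpha$ on $[K]$ for which $\Phi^\top\mathrm{diag}(\alpha)\Phi$ is invertible, the weighted least-squares estimate $\arg\min_{\theta}\sum_{i=1}^K\alpha_i(\phi_i^\top\theta-\mu_i)^2$ lies in $\Theta_k$. A vector $\mu$ is an interior point of $\mathcal C_k$ if for some $\delta>0$ the cell $\prod_{i=1}^K(\mu_i-\delta,\mu_i+\delta)$ is contained in $\mathcal C_k$. Consider a $K$-armed bandit with reward laws $\nu_1,\dots,\nu_K$ on $\mathbb R$, with means $\mu_1,\dots,\mu_K$, that are $\tfrac12$-sub-Gaussian: $\int e^{s(y-\mu_i)}\,d\nu_i(y)\le e^{s^2/8}$ for all $s\in\mathbb R$ and all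 $i$. Given the past and the arm $A_t=i$ played in round $t$, the reward $Y_t$ has law $\nu_i$. The $\varepsilon$-greedy algorithm with $\varepsilon_t=1/\sqrt t$ computes, in round $t$, a least-squares estimate $\hat\theta_t\in\arg\min_\theta\sum_{s<t}(\phi_{A_s}^\top\theta-Y_s)^2$ and, conditionally on the past, plays an arm in $\arg\max_{i}\phi_i^\top\hat\theta_t$ with probability $1-\varepsilon_t$ and a uniformly random arm with probability $\varepsilon_t$; minimizers and maximizers that are not unique may be chosen arbitrarily on the basis of the past. The algorithm may be preceded by $n_0\ge0$ initial rounds (counted in $t$) with arbitrary play, for instance to sample $d$ linearly independent features; $n_0=0$ means no initial phase. If $\mu$ is an interior point of $\mathcal C_k$, then the expected regret is $O(\Delta_{\max}\sqrt T)$, where $\Delta_{\max}=\max_{i\in[K]}(\mu_k-\mu_i)$. More precisely, for all $K$, $n_0$ and $\delta>0$ there is a constant $C=C(K,n_0,\delta)$ such that, whenever $\prod_{i=1}^K(\mu_i-\delta,\mu_i+\delta)\subseteq\mathcal C_k$, $$\mathbb E\Big[\sum_{t=1}^T(\mu_k-\mu_{A_t})\Big]\le C\,\Delta_{\max}\sqrt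 T\qquad\text{for all } T\ge 0 .$$ -/

import Mathlib

open MeasureTheory ProbabilityTheory
open scoped Matrix NNReal

/-- The greedy region `R_k`: reward vectors for which arm `k` is the unique best arm. -/
def greedyRegion {K : ℕ} (k : Fin K) : Set (Fin K → ℝ) :=
  {μ | ∀ i, i ≠ k → μ i < μ k}

/-- `θ ∈ argmin_θ ‖Φ θ - μ‖²`, where the squared norm has weight `α i` in coordinate `i`
(the rows of `Φ` are the feature vectors of the arms). -/
def IsModelEstimate {K d : ℕ} (Φ : Matrix (Fin K) (Fin d) ℝ) (α μ : Fin K → ℝ)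
    (θ : Fin d → ℝ) : Prop :=
  ∀ θ' : Fin d → ℝ,
    ∑ i, α i * ((Φ *ᵥ θ) i - μ i) ^ 2 ≤ ∑ i, α i * ((Φ *ᵥ θ') i - μ i) ^ 2

/-- The robust parameter region `Θ_k`. -/
def robustParameterRegion {K d : ℕ} (Φ : Matrix (Fin K) (Fin d) ℝ) (k : Fin K) :
    Set (Fin d → ℝ) :=
  {θ | Φ *ᵥ θ ∈ greedyRegion k}

/-- The robust observation region `C_k`: arm `k` is optimal for `μ`, and for every sampling
distribution `α` with `Φᵀ diag(α) Φ` invertible the (then unique) model estimate of `μ` lies in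
`Θ_k`. -/
def robustObservationRegion {K d : ℕ} (Φ : Matrix (Fin K) (Fin d) ℝ) (k : Fin K) :
    Set (Fin K → ℝ) :=
  {μ | μ ∈ greedyRegion k ∧
    ∀ α ∈ stdSimplex ℝ (Fin K), IsUnit (Φᵀ * Matrix.diagonal α * Φ) →
      ∀ θ, IsModelEstimate Φ α μ θ → θ ∈ robustParameterRegion Φ k}

/-- The open `K`-dimensional cell of size `δ` centred at `μ`. A vector `μ` is an interior point of
a set `S` when `cell μ δ ⊆ S` for some `δ > 0`. -/
def cell {K : ℕ} (μ : Fin K → ℝ) (δ : ℝ) : Set (Fin K → ℝ) :=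
  {ξ | ∀ i, ξ i ∈ Set.Ioo (μ i - δ) (μ i + δ)}

/-- The largest sub-optimality gap `max_i (μ_k - μ_i)`. -/
noncomputable def maxGap {K : ℕ} (μ : Fin K → ℝ) (k : Fin K) : ℝ :=
  Finset.univ.sup' ⟨k, Finset.mem_univ k⟩ (fun i => μ k - μ i)

/-- The `K`-armed bandit with reward distributions `ν i` has mean vector `μ` and `σ`-sub-Gaussian
rewards: `∫ exp (s (y - μ i)) dν i ≤ exp (σ² s² / 2)` for all real `s`. -/
structure IsSubgaussianBandit {K : ℕ} (ν : Fin K → Measure ℝ) (μ : Fin K → ℝ) (σ : ℝ≥0) :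
    Prop where
  isProbabilityMeasure : ∀ i, IsProbabilityMeasure (ν i)
  mean_eq : ∀ i, ∫ y, y ∂(ν i) = μ i
  subgaussian : ∀ i, HasSubgaussianMGF (fun y => y - μ i) (σ ^ 2) (ν i)

/-- `A t` and `Y t` are the arm and the reward of round `t = 1, 2, …` when the bandit with reward
distributions `ν` is played by some policy; `ℱ t` is the information available after round `t`.
Conditionally on `ℱ t` and on `A (t + 1) = i`, the reward `Y (t + 1)` has law `ν i`. -/
structure IsBanditInteraction {K : ℕ} {Ω : Type*} {mΩ : MeasurableSpace Ω} (P : Measure Ω)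
    (ν : Fin K → Measure ℝ) (ℱ : Filtration ℕ mΩ) (A : ℕ → Ω → Fin K) (Y : ℕ → Ω → ℝ) :
    Prop where
  measurable_arm : ∀ t, Measurable[ℱ (t + 1)] (A (t + 1))
  measurable_reward : ∀ t, Measurable[ℱ (t + 1)] (Y (t + 1))
  reward_law : ∀ (t : ℕ) (S : Set Ω), MeasurableSet[ℱ t] S → ∀ (i : Fin K) (B : Set ℝ),
    MeasurableSet B →
      P (S ∩ A (t + 1) ⁻¹' {i} ∩ Y (t + 1) ⁻¹' B) = P (S ∩ A (t + 1) ⁻¹' {i}) * ν i B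

/-- From round `n₀ + 1` on, the arms `A` are played by the `ε`-greedy algorithm with least-squares
estimates. In round `t + 1`, `θ (t + 1)` is a minimizer of `∑_{s ≤ t} (φ_{A_s}ᵀ θ - Y_s)²`,
`G (t + 1)` is an arm maximizing `φ_iᵀ θ (t + 1)`, and, conditionally on the past `ℱ t`, the
algorithm plays `G (t + 1)` with probability `1 - ε (t + 1)` and a uniformly random arm with
probability `ε (t + 1)`. Any choice among several minimizers or maximizers is allowed.
The first `n₀` rounds are unrestricted (`n₀ = 0`: no initial phase). -/
structure IsEpsGreedy {K d : ℕ} {Ω : Type*} {mΩ : MeasurableSpace Ω} (P : Measure Ω)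
    (Φ : Matrix (Fin K) (Fin d) ℝ) (ε : ℕ → ℝ) (n₀ : ℕ) (ℱ : Filtration ℕ mΩ)
    (A : ℕ → Ω → Fin K) (Y : ℕ → Ω → ℝ) (θ : ℕ → Ω → Fin d → ℝ) (G : ℕ → Ω → Fin K) :
    Prop where
  leastSquares : ∀ t, n₀ ≤ t → ∀ ω, ∀ θ' : Fin d → ℝ,
    ∑ s ∈ Finset.Icc 1 t, ((Φ *ᵥ θ (t + 1) ω) (A s ω) - Y s ω) ^ 2
      ≤ ∑ s ∈ Finset.Icc 1 t, ((Φ *ᵥ θ') (A s ω) - Y s ω) ^ 2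
  greedy : ∀ t, n₀ ≤ t → ∀ ω, ∀ i,
    (Φ *ᵥ θ (t + 1) ω) i ≤ (Φ *ᵥ θ (t + 1) ω) (G (t + 1) ω)
  measurable_greedy : ∀ t, n₀ ≤ t → Measurable[ℱ t] (G (t + 1))
  arm_law : ∀ t, n₀ ≤ t → ∀ S : Set Ω, MeasurableSet[ℱ t] S → ∀ i : Fin K,
    P.real (S ∩ A (t + 1) ⁻¹' {i}) =
      (1 - ε (t + 1)) * P.real (S ∩ G (t + 1) ⁻¹' {i}) + ε (t + 1) * (P.real S / K)

/-- The expected regret `E ∑_{t=1}^T (μ_k - μ_{A_t})` of the plays `A`, `k` being the best arm. -/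
noncomputable def expectedRegret {K : ℕ} {Ω : Type*} {mΩ : MeasurableSpace Ω} (P : Measure Ω)
    (μ : Fin K → ℝ) (k : Fin K) (A : ℕ → Ω → Fin K) (T : ℕ) : ℝ :=
  ∫ ω, ∑ t ∈ Finset.Icc 1 T, (μ k - μ (A t ω)) ∂P

/-! ### The least-squares estimate from accurate observations -/

/-! Grouped by arm, the squared residuals form, up to a constant, a weighted least-squares objective
for the vector of empirical means, weighted by play counts. Once all arms are observed and these
means lie in the cell, robustness makes `k` the greedy arm, whatever the counts are
(`mem_robustParameterRegion_of_leastSquares`). Failure for arm `i` means that the deviation sum `S`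
and the count `N` satisfy `|S| ≥ δ N`, which includes `N = 0`. Then `exp (l S - 4 δ² N) ≥ 1` for `l
= 4 δ` or `l = -4 δ`. Each play of `i` multiplies the mean of this weight by at most `exp (-2 δ²)`,
and exploration plays `i` with conditional probability at least `ε / K`. So the mean decays like
`exp (-κ √t)` (`IsEpsGreedy.lintegral_tiltedWeight_le`), with no separate concentration bound for
counts. Markov's inequality and a union bound make both a wrong greedy arm and exploration cost `O(1
/ √t)` per round, which sums to `O(√T)`. -/

theorem Matrix.mulVec_injective_of_rank_eq {K d : ℕ} {Φ : Matrix (Fin K) (Fin d) ℝ}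
    (h : Φ.rank = d) : Function.Injective Φ.mulVec := by
  rw [Matrix.mulVec_injective_iff, linearIndependent_iff_card_eq_finrank_span, Set.finrank,
    ← Matrix.rank_eq_finrank_span_cols, h, Fintype.card_fin]

theorem isUnit_transpose_mul_diagonal_mul {K d : ℕ} {Φ : Matrix (Fin K) (Fin d) ℝ}
    (h : Φ.rank = d) {α : Fin K → ℝ} (hα : ∀ i, 0 < α i) :
    IsUnit (Φᵀ * Matrix.diagonal α * Φ) := by
  have := ((Matrix.PosDef.diagonal hα).conjTranspose_mul_mul_same
    (Matrix.mulVec_injective_of_rank_eq h)).isUnit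
  rwa [Matrix.conjTranspose_eq_transpose_of_trivial] at this

/-- Decomposition of a sum of squared residuals into its value at the mean and a bias term. -/
theorem sum_sq_sub_eq_card_mul_add {ι : Type*} (I : Finset ι) (y : ι → ℝ) {m : ℝ}
    (hm : ∑ s ∈ I, y s = I.card * m) (x : ℝ) :
    ∑ s ∈ I, (x - y s) ^ 2 = I.card * (x - m) ^ 2 + ∑ s ∈ I, (y s - m) ^ 2 := by
  have h : ∀ s, (x - y s) ^ 2 = (x - m) ^ 2 + (y s - m) ^ 2 + 2 * (x - m) * m
      - 2 * (x - m) * y s := fun s => by ring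
  simp_rw [h, Finset.sum_sub_distrib, Finset.sum_add_distrib, ← Finset.mul_sum, hm,
    Finset.sum_const, nsmul_eq_mul]
  ring

/-- If every arm has been observed and every empirical mean is `δ`-close to the true mean, then
every least-squares estimate lies in the robust parameter region. -/
theorem mem_robustParameterRegion_of_leastSquares {K d : ℕ} {Φ : Matrix (Fin K) (Fin d) ℝ}
    (hΦ : Φ.rank = d) {k : Fin K} {μ : Fin K → ℝ} {δ : ℝ}
    (hμ : cell μ δ ⊆ robustObservationRegion Φ k) {ι : Type*} (I : Finset ι)
    (a : ι → Fin K) (y : ι → ℝ) {θ : Fin d → ℝ}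
    (hθ : ∀ θ' : Fin d → ℝ, ∑ s ∈ I, ((Φ *ᵥ θ) (a s) - y s) ^ 2
      ≤ ∑ s ∈ I, ((Φ *ᵥ θ') (a s) - y s) ^ 2)
    (hdev : ∀ i, |∑ s ∈ I with a s = i, (y s - μ i)| < δ * (I.filter (a · = i)).card) :
    θ ∈ robustParameterRegion Φ k := by
  set N : Fin K → ℝ := fun i => (I.filter (a · = i)).card with hN
  -- The strict inequality `hdev` fails for an unobserved arm, so it also forces every count to be
  -- positive.
  have hNpos : ∀ i, 0 < N i := fun i => by
    have h0 : (0 : ℝ) ≤ N i := Nat.cast_nonneg _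
    refine h0.lt_of_ne fun h => ?_
    have := (abs_nonneg _).trans_lt (hdev i)
    simp only [hN] at h
    rw [← h, mul_zero] at this
    exact this.false
  set m : Fin K → ℝ := fun i => (∑ s ∈ I with a s = i, y s) / N i with hm
  have hmN : ∀ i, ∑ s ∈ I with a s = i, y s = N i * m i := fun i => by
    rw [hm]; field_simp [(hNpos i).ne']
  have hmcell : m ∈ cell μ δ := fun i => by
    have h := hdev i
    rw [Finset.sum_sub_distrib, hmN, Finset.sum_const, nsmul_eq_mul, ← mul_sub, abs_mul,
      abs_of_pos (hNpos i), mul_comm] at h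
    have h := lt_of_mul_lt_mul_right h (hNpos i).le
    rw [abs_lt] at h
    constructor <;> linarith
  have hsum : ∀ θ' : Fin d → ℝ, ∑ s ∈ I, ((Φ *ᵥ θ') (a s) - y s) ^ 2 =
      ∑ i, N i * ((Φ *ᵥ θ') i - m i) ^ 2 + ∑ i, ∑ s ∈ I with a s = i, (y s - m i) ^ 2 := by
    intro θ'
    rw [← Finset.sum_add_distrib, ← Finset.sum_fiberwise I a]
    refine Finset.sum_congr rfl fun i _ => ?_
    rw [← sum_sq_sub_eq_card_mul_add _ y (hmN i)]
    refine Finset.sum_congr rfl fun s hs => ?_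
    rw [(Finset.mem_filter.mp hs).2]
  have hS : 0 < ∑ i, N i := Finset.sum_pos (fun i _ => hNpos i) ⟨k, Finset.mem_univ k⟩
  refine (hμ hmcell).2 (fun i => N i / ∑ j, N j)
    ⟨fun i => (div_pos (hNpos i) hS).le, ?_⟩
    (isUnit_transpose_mul_diagonal_mul hΦ fun i => div_pos (hNpos i) hS) θ fun θ' => ?_
  · rw [← Finset.sum_div, div_self hS.ne']
  · have h := hθ θ'
    rw [hsum, hsum] at h
    have h := le_of_add_le_add_right h
    simp only [div_mul_eq_mul_div, ← Finset.sum_div _ _ (∑ j, N j)]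
    exact div_le_div_of_nonneg_right h hS.le

/-! ### Conditional laws of rewards and arms -/

section Interaction

variable {K : ℕ} {Ω : Type*} {mΩ : MeasurableSpace Ω} {P : Measure Ω}
  {ν : Fin K → Measure ℝ} {ℱ : Filtration ℕ mΩ} {A : ℕ → Ω → Fin K} {Y : ℕ → Ω → ℝ}

theorem IsBanditInteraction.measurableSet_arm (h : IsBanditInteraction P ν ℱ A Y) (t : ℕ)
    (i : Fin K) : MeasurableSet (A (t + 1) ⁻¹' {i}) :=
  ℱ.le (t + 1) _ (h.measurable_arm t (measurableSet_singleton i))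

/-- Conditionally on the past and on `A (t + 1) = i`, the reward `Y (t + 1)` has law `ν i`, in terms
of nonnegative integrands. -/
theorem IsBanditInteraction.setLIntegral_mul_reward (h : IsBanditInteraction P ν ℱ A Y) (t : ℕ)
    (i : Fin K) {W : Ω → ENNReal} (hW : Measurable[ℱ t] W) {g : ℝ → ENNReal} (hg : Measurable g) :
    ∫⁻ ω in A (t + 1) ⁻¹' {i}, W ω * g (Y (t + 1) ω) ∂P =
      (∫⁻ ω in A (t + 1) ⁻¹' {i}, W ω ∂P) * ∫⁻ y, g y ∂(ν i) := by
  set Q := P.restrict (A (t + 1) ⁻¹' {i}) with hQ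
  have hY : Measurable (Y (t + 1)) := (h.measurable_reward t).mono (ℱ.le _) le_rfl
  have hset : ∀ S, MeasurableSet[ℱ t] S →
      ∫⁻ ω in S, g (Y (t + 1) ω) ∂Q = (∫⁻ y, g y ∂(ν i)) * Q S := by
    intro S hS
    have hS' := ℱ.le t _ hS
    have hmap : (Q.restrict S).map (Y (t + 1)) = Q S • ν i := by
      ext B hB
      rw [Measure.map_apply hY hB, Measure.restrict_apply (hY hB), Measure.smul_apply, smul_eq_mul,
        hQ, Measure.restrict_apply ((hY hB).inter hS'), Measure.restrict_apply hS',
        ← h.reward_law t S hS i B hB]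
      congr 1
      ext ω
      simp only [Set.mem_inter_iff]
      tauto
    rw [← lintegral_map hg hY, hmap, lintegral_smul_measure, smul_eq_mul, mul_comm]
  -- Agreement on the sets of `ℱ t` is equality of measures trimmed to `ℱ t`, hence passes to every
  -- `ℱ t`-measurable integrand.
  have htrim : (Q.withDensity fun ω => g (Y (t + 1) ω)).trim (ℱ.le t) =
      (∫⁻ y, g y ∂(ν i)) • Q.trim (ℱ.le t) := by
    refine @Measure.ext _ (ℱ t) _ _ fun S hS => ?_
    rw [trim_measurableSet_eq _ hS, withDensity_apply _ (ℱ.le t _ hS), hset S hS,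
      Measure.smul_apply, trim_measurableSet_eq _ hS, smul_eq_mul]
  have hW' : Measurable W := hW.mono (ℱ.le t) le_rfl
  calc ∫⁻ ω, W ω * g (Y (t + 1) ω) ∂Q
      = ∫⁻ ω, W ω ∂(Q.withDensity fun ω => g (Y (t + 1) ω)) := by
        refine Eq.trans ?_ (lintegral_withDensity_eq_lintegral_mul Q (hg.comp hY) hW').symm
        simp [mul_comm]
    _ = ∫⁻ ω, W ω ∂((Q.withDensity fun ω => g (Y (t + 1) ω)).trim (ℱ.le t)) :=
        (lintegral_trim _ hW).symm
    _ = _ := by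
        rw [htrim, lintegral_smul_measure, lintegral_trim _ hW, smul_eq_mul, mul_comm]

/-- Every arm is explored with conditional probability at least `ε (t + 1) / K`. -/
theorem IsEpsGreedy.exploration_le_setLIntegral {d n₀ : ℕ} {Φ : Matrix (Fin K) (Fin d) ℝ}
    {ε : ℕ → ℝ} {θ : ℕ → Ω → Fin d → ℝ} {G : ℕ → Ω → Fin K} [IsFiniteMeasure P]
    (h : IsEpsGreedy P Φ ε n₀ ℱ A Y θ G)
    {t : ℕ} (ht : n₀ ≤ t) (hε₀ : 0 ≤ ε (t + 1)) (hε : ε (t + 1) ≤ 1) (i : Fin K)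
    {W : Ω → ENNReal} (hW : Measurable[ℱ t] W) :
    ENNReal.ofReal (ε (t + 1) / K) * ∫⁻ ω, W ω ∂P ≤ ∫⁻ ω in A (t + 1) ⁻¹' {i}, W ω ∂P := by
  have hle : ENNReal.ofReal (ε (t + 1) / K) • P.trim (ℱ.le t) ≤
      (P.restrict (A (t + 1) ⁻¹' {i})).trim (ℱ.le t) := by
    refine @Measure.le_intro _ (ℱ t) _ _ fun S hS _ => ?_
    rw [Measure.smul_apply, trim_measurableSet_eq _ hS, trim_measurableSet_eq _ hS,
      Measure.restrict_apply (ℱ.le t _ hS), smul_eq_mul, ← ofReal_measureReal (μ := P) (s := S),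
      ← ENNReal.ofReal_mul (by positivity),
      ← ofReal_measureReal (μ := P) (s := S ∩ A (t + 1) ⁻¹' {i}), h.arm_law t ht S hS i]
    refine ENNReal.ofReal_le_ofReal ?_
    have : 0 ≤ (1 - ε (t + 1)) * P.real (S ∩ G (t + 1) ⁻¹' {i}) :=
      mul_nonneg (by linarith) measureReal_nonneg
    calc ε (t + 1) / K * P.real S = ε (t + 1) * (P.real S / K) := by ring
      _ ≤ _ := by linarith
  have := lintegral_mono' hle (le_refl W)
  rwa [lintegral_smul_measure, lintegral_trim _ hW, lintegral_trim _ hW, smul_eq_mul] at this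

/-! ### Exponential tail bounds for the cumulative rewards -/

/-- The exponential of the tilted cumulative reward `∑ (l (Y_s - m) - c)` over the rounds `s ≤ t` in
which arm `i` is played. -/
noncomputable def tiltedWeight (A : ℕ → Ω → Fin K) (Y : ℕ → Ω → ℝ) (i : Fin K) (m l c : ℝ) (t : ℕ)
    (ω : Ω) : ENNReal :=
  ENNReal.ofReal (Real.exp (∑ s ∈ Finset.Icc 1 t, if A s ω = i then l * (Y s ω - m) - c else 0))

theorem IsBanditInteraction.measurable_tiltedWeight (h : IsBanditInteraction P ν ℱ A Y)
    (i : Fin K) (m l c : ℝ) (t : ℕ) : Measurable[ℱ t] (tiltedWeight A Y i m l c t) := by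
  refine ENNReal.measurable_ofReal.comp (Real.measurable_exp.comp ?_)
  refine Finset.measurable_sum _ fun s hs => ?_
  obtain ⟨h1, h2⟩ := Finset.mem_Icc.mp hs
  obtain ⟨r, rfl⟩ := Nat.exists_eq_add_of_le' h1
  have hA := (h.measurable_arm r).mono (ℱ.mono h2) le_rfl
  have hY := (h.measurable_reward r).mono (ℱ.mono h2) le_rfl
  exact Measurable.ite (hA (measurableSet_singleton i))
    (((hY.sub_const m).const_mul l).sub_const c) measurable_const

theorem tiltedWeight_succ (A : ℕ → Ω → Fin K) (Y : ℕ → Ω → ℝ) (i : Fin K) (m l c : ℝ) (t : ℕ)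
    (ω : Ω) : tiltedWeight A Y i m l c (t + 1) ω = tiltedWeight A Y i m l c t ω *
      if A (t + 1) ω = i then ENNReal.ofReal (Real.exp (l * (Y (t + 1) ω - m) - c)) else 1 := by
  unfold tiltedWeight
  rw [Finset.sum_Icc_succ_top (by omega), Real.exp_add, ENNReal.ofReal_mul (Real.exp_nonneg _)]
  split_ifs <;> simp

theorem IsSubgaussianBandit.lintegral_exp_le {μ : Fin K → ℝ} (hν : IsSubgaussianBandit ν μ (1 / 2))
    (i : Fin K) (l c : ℝ) :
    ∫⁻ y, ENNReal.ofReal (Real.exp (l * (y - μ i) - c)) ∂(ν i) ≤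
      ENNReal.ofReal (Real.exp (l ^ 2 / 8 - c)) := by
  have hint := (hν.subgaussian i).integrable_exp_mul l
  have hmgf := (hν.subgaussian i).mgf_le l
  simp_rw [Real.exp_sub, div_eq_mul_inv]
  rw [← ofReal_integral_eq_lintegral_ofReal (hint.mul_const _)
    (Filter.Eventually.of_forall fun y => by positivity), integral_mul_const]
  refine ENNReal.ofReal_le_ofReal (mul_le_mul_of_nonneg_right (hmgf.trans_eq ?_) (by positivity))
  congr 1
  push_cast
  ring

/-- Here `a` and `b` are the masses of the weight where the arm is played and where it is not: `a q
+ b = (a + b) - (1 - q) a`, and `a ≥ p (a + b)`. -/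
theorem ENNReal.ofReal_mul_add_le_of_mul_le {a b : ENNReal} {p q r : ℝ} (hq₀ : 0 ≤ q) (hq : q ≤ 1)
    (hp₀ : 0 ≤ p) (hp : p ≤ 1) (hr : 0 ≤ r) (hab : a + b ≤ ENNReal.ofReal r)
    (ha : ENNReal.ofReal p * (a + b) ≤ a) :
    a * ENNReal.ofReal q + b ≤ ENNReal.ofReal ((1 - (1 - q) * p) * r) := by
  have hfin : a + b ≠ ⊤ := ne_top_of_le_ne_top ENNReal.ofReal_ne_top hab
  lift a to ℝ≥0 using (ENNReal.add_ne_top.mp hfin).1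
  lift b to ℝ≥0 using (ENNReal.add_ne_top.mp hfin).2
  lift p to ℝ≥0 using hp₀
  lift q to ℝ≥0 using hq₀
  lift r to ℝ≥0 using hr
  simp only [ENNReal.ofReal_coe_nnreal] at *
  norm_cast at hab ha
  have hab' : (a : ℝ) + b ≤ r := mod_cast hab
  have ha' : (p : ℝ) * (a + b) ≤ a := mod_cast ha
  have hs : 0 ≤ 1 - (1 - (q : ℝ)) * p := by nlinarith [p.2, q.2]
  rw [← ENNReal.coe_mul, ← ENNReal.coe_add, ← ENNReal.ofReal_coe_nnreal]
  refine ENNReal.ofReal_le_ofReal ?_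
  push_cast
  have h1 := mul_le_mul_of_nonneg_left hab' hs
  have h2 := mul_le_mul_of_nonneg_left ha' (sub_nonneg.mpr hq)
  linarith

/-- One round multiplies the expectation of the tilted weight by at most `1 - (1 - q) p`, where `p`
bounds the conditional probability of arm `i` from below and `q` is the tilted moment. -/
theorem IsBanditInteraction.lintegral_tiltedWeight_succ_le (h : IsBanditInteraction P ν ℱ A Y)
    {μ : Fin K → ℝ} (hν : IsSubgaussianBandit ν μ (1 / 2)) (i : Fin K) {l c p r : ℝ} {t : ℕ}
    (hlc : l ^ 2 / 8 ≤ c) (hp₀ : 0 ≤ p) (hp : p ≤ 1) (hr : 0 ≤ r)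
    (hw : ∫⁻ ω, tiltedWeight A Y i (μ i) l c t ω ∂P ≤ ENNReal.ofReal r)
    (hpa : ENNReal.ofReal p * ∫⁻ ω, tiltedWeight A Y i (μ i) l c t ω ∂P ≤
      ∫⁻ ω in A (t + 1) ⁻¹' {i}, tiltedWeight A Y i (μ i) l c t ω ∂P) :
    ∫⁻ ω, tiltedWeight A Y i (μ i) l c (t + 1) ω ∂P ≤
      ENNReal.ofReal ((1 - (1 - Real.exp (l ^ 2 / 8 - c)) * p) * r) := by
  have hE := h.measurableSet_arm t i
  rw [← lintegral_add_compl _ hE] at hw hpa ⊢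
  refine le_trans (add_le_add ?_ ?_) (ENNReal.ofReal_mul_add_le_of_mul_le (Real.exp_nonneg _)
    (Real.exp_le_one_iff.mpr (by linarith)) hp₀ hp hr hw hpa)
  · calc ∫⁻ ω in A (t + 1) ⁻¹' {i}, tiltedWeight A Y i (μ i) l c (t + 1) ω ∂P
        = ∫⁻ ω in A (t + 1) ⁻¹' {i}, tiltedWeight A Y i (μ i) l c t ω *
            ENNReal.ofReal (Real.exp (l * (Y (t + 1) ω - μ i) - c)) ∂P := by
          refine setLIntegral_congr_fun hE fun ω hω => ?_
          have hω : A (t + 1) ω = i := hω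
          simp only [tiltedWeight_succ, hω, if_true]
      _ = _ := h.setLIntegral_mul_reward t i (h.measurable_tiltedWeight i _ _ _ t)
          (g := fun y => ENNReal.ofReal (Real.exp (l * (y - μ i) - c))) (by fun_prop)
      _ ≤ _ := by gcongr; exact hν.lintegral_exp_le i l c
  · refine (setLIntegral_congr_fun hE.compl fun ω hω => ?_).le
    have hω : A (t + 1) ω ≠ i := hω
    simp only [tiltedWeight_succ, hω, if_false, mul_one]

end Interaction

section EpsGreedy

variable {K d n₀ : ℕ} {Ω : Type*} {mΩ : MeasurableSpace Ω} {P : Measure Ω}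
  {ν : Fin K → Measure ℝ} {ℱ : Filtration ℕ mΩ} {A : ℕ → Ω → Fin K} {Y : ℕ → Ω → ℝ}
  {Φ : Matrix (Fin K) (Fin d) ℝ} {θ : ℕ → Ω → Fin d → ℝ} {G : ℕ → Ω → Fin K} {μ : Fin K → ℝ}

theorem one_div_sqrt_succ_le_one (t : ℕ) : 1 / √((t + 1 : ℕ) : ℝ) ≤ 1 := by
  have h : (1 : ℝ) ≤ √((t + 1 : ℕ) : ℝ) := Real.one_le_sqrt.mpr (by simp)
  exact (div_le_one (by linarith)).mpr h

theorem IsEpsGreedy.lintegral_tiltedWeight_le [IsProbabilityMeasure P]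
    (hA : IsBanditInteraction P ν ℱ A Y)
    (h : IsEpsGreedy P Φ (fun t => 1 / √(t : ℝ)) n₀ ℱ A Y θ G)
    (hν : IsSubgaussianBandit ν μ (1 / 2)) (i : Fin K) {l c : ℝ} (hlc : l ^ 2 / 8 ≤ c) {T t : ℕ}
    (ht : t ≤ T) :
    ∫⁻ ω, tiltedWeight A Y i (μ i) l c t ω ∂P ≤ ENNReal.ofReal (Real.exp
      (-((1 - Real.exp (l ^ 2 / 8 - c)) / K / √(T : ℝ) * ((t - n₀ : ℕ) : ℝ)))) := by
  have hK : (1 : ℝ) ≤ K := mod_cast i.pos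
  induction t with
  | zero => simp [tiltedWeight]
  | succ t ih =>
    specialize ih (by omega)
    have hq : 0 ≤ 1 - Real.exp (l ^ 2 / 8 - c) :=
      sub_nonneg.mpr (Real.exp_le_one_iff.mpr (by linarith))
    set q := Real.exp (l ^ 2 / 8 - c)
    rcases lt_or_ge t n₀ with hlt | hge
    -- In the initial phase nothing is known about exploration; `p = 0` still shows that the mean
    -- does not grow.
    · have := hA.lintegral_tiltedWeight_succ_le hν i hlc le_rfl zero_le_one (Real.exp_nonneg _) ih
        (by simp)
      refine this.trans_eq ?_
      rw [Nat.sub_eq_zero_of_le hlt.le, Nat.sub_eq_zero_of_le hlt]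
      simp
    · have hε := one_div_sqrt_succ_le_one t
      have hp := h.exploration_le_setLIntegral hge (by positivity) hε i
        (hA.measurable_tiltedWeight i (μ i) l c t)
      refine (hA.lintegral_tiltedWeight_succ_le hν i hlc (by positivity)
        ((div_le_self (by positivity) hK).trans hε) (Real.exp_nonneg _) ih hp).trans
        (ENNReal.ofReal_le_ofReal ?_)
      rw [Nat.succ_sub hge]
      push_cast
      rw [mul_add, mul_one, neg_add_rev, Real.exp_add]
      refine mul_le_mul_of_nonneg_right ?_ (Real.exp_nonneg _)
      refine le_trans ?_ (Real.one_sub_le_exp_neg _)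
      -- All exploration rates up to `T` are at least `1 / √T`, which gives one uniform contraction
      -- factor.
      have hT : √((t : ℝ) + 1) ≤ √(T : ℝ) := Real.sqrt_le_sqrt (mod_cast ht)
      have hpos : 0 < √((t : ℝ) + 1) := by positivity
      have hmono : 1 / √(T : ℝ) ≤ 1 / √((t : ℝ) + 1) := by gcongr
      have := mul_le_mul_of_nonneg_left hmono (div_nonneg hq (by positivity : (0 : ℝ) ≤ K))
      rw [sub_le_sub_iff_left]
      calc (1 - q) / K / √(T : ℝ) = (1 - q) / K * (1 / √(T : ℝ)) := by ring
        _ ≤ _ := this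
        _ = _ := by ring

/-! ### Probability of a suboptimal play -/

theorem one_sub_exp_div_pos {δ : ℝ} (hδ : 0 < δ) {K : ℕ} (hK : 0 < K) :
    0 < (1 - Real.exp (-(2 * δ ^ 2))) / K :=
  div_pos (sub_pos.mpr (Real.exp_lt_one_iff.mpr (by simp; positivity))) (Nat.cast_pos.mpr hK)

/-- With `x = √(t + 1) ≥ 1`, `(t - n₀) / x = x - (n₀ + 1) / x ≥ x - (n₀ + 1)`, and `exp (-κ x) ≤ 1 /
(κ x)`. This crude bound suffices because exploration already costs `1 / x`. -/
theorem exp_neg_mul_div_sqrt_le {κ : ℝ} (hκ : 0 < κ) {n₀ t : ℕ} (ht : n₀ ≤ t) :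
    Real.exp (-(κ / √((t + 1 : ℕ) : ℝ) * ((t - n₀ : ℕ) : ℝ))) ≤
      Real.exp (κ * (n₀ + 1)) / κ / √((t + 1 : ℕ) : ℝ) := by
  have hx1 : (1 : ℝ) ≤ √((t + 1 : ℕ) : ℝ) := Real.one_le_sqrt.mpr (by simp)
  have hx2 : √((t + 1 : ℕ) : ℝ) ^ 2 = t + 1 := by
    rw [Real.sq_sqrt (by positivity)]; push_cast; rfl
  set x := √((t + 1 : ℕ) : ℝ)
  have hx0 : 0 < x := by linarith
  have hexp : -(κ / x * ((t - n₀ : ℕ) : ℝ)) ≤ κ * (n₀ + 1) - κ * x := by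
    have h1 : (((t - n₀ : ℕ) : ℝ)) = x ^ 2 - (n₀ + 1) := by
      rw [hx2]; push_cast [ht]; ring
    have h2 : -(κ / x * (x ^ 2 - (n₀ + 1))) = κ * ((n₀ + 1) / x) - κ * x := by
      field_simp; ring
    rw [h1, h2]
    gcongr
    exact div_le_self (by positivity) hx1
  refine (Real.exp_le_exp.mpr hexp).trans ?_
  rw [Real.exp_sub, div_div]
  gcongr
  linarith [Real.add_one_le_exp (κ * x)]

/-- If no cumulative deviation is large, then the greedy arm is the optimal one. -/
theorem IsEpsGreedy.greedy_eq {δ : ℝ} (hδ : 0 < δ) {ε : ℕ → ℝ}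
    (h : IsEpsGreedy P Φ ε n₀ ℱ A Y θ G) (hΦ : Φ.rank = d) {k : Fin K}
    (hμ : cell μ δ ⊆ robustObservationRegion Φ k) {t : ℕ} (ht : n₀ ≤ t) {ω : Ω}
    (hω : ∀ i, ∀ l : ℝ, l = 4 * δ ∨ l = -(4 * δ) →
      tiltedWeight A Y i (μ i) l (4 * δ ^ 2) t ω < 1) : G (t + 1) ω = k := by
  have hθ := mem_robustParameterRegion_of_leastSquares hΦ hμ (Finset.Icc 1 t)
    (fun s => A s ω) (fun s => Y s ω) (h.leastSquares t ht ω) fun i => by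
      have hdev : ∀ l : ℝ, l = 4 * δ ∨ l = -(4 * δ) →
          l * (∑ s ∈ Finset.Icc 1 t with A s ω = i, (Y s ω - μ i)) <
            4 * δ ^ 2 * ((Finset.Icc 1 t).filter (A · ω = i)).card := by
        intro l hl
        have := hω i l hl
        rw [tiltedWeight, ← ENNReal.ofReal_one,
          ENNReal.ofReal_lt_ofReal_iff zero_lt_one, Real.exp_lt_one_iff, ← Finset.sum_filter,
          Finset.sum_sub_distrib, ← Finset.mul_sum, Finset.sum_const, nsmul_eq_mul] at this
        linarith
      have h1 := hdev _ (Or.inl rfl)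
      have h2 := hdev _ (Or.inr rfl)
      have hδ4 : 0 < 4 * δ := by positivity
      rw [abs_lt]
      constructor
      · refine lt_of_mul_lt_mul_left (a := 4 * δ) ?_ hδ4.le
        linarith
      · refine lt_of_mul_lt_mul_left (a := 4 * δ) ?_ hδ4.le
        linarith
  by_contra hne
  exact (hθ _ hne).not_ge (h.greedy t ht ω k)

/-- The greedy arm of round `t + 1` is suboptimal with probability `O(1 / √(t + 1))`. -/
theorem IsEpsGreedy.measureReal_greedy_ne_le [IsProbabilityMeasure P] {δ : ℝ} (hδ : 0 < δ)
    (hA : IsBanditInteraction P ν ℱ A Y)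
    (h : IsEpsGreedy P Φ (fun t => 1 / √(t : ℝ)) n₀ ℱ A Y θ G)
    (hν : IsSubgaussianBandit ν μ (1 / 2)) (hΦ : Φ.rank = d) {k : Fin K}
    (hμ : cell μ δ ⊆ robustObservationRegion Φ k) {κ : ℝ}
    (hκ : κ = (1 - Real.exp (-(2 * δ ^ 2))) / K) {t : ℕ} (ht : n₀ ≤ t) :
    P.real (G (t + 1) ⁻¹' {k})ᶜ ≤
      2 * K * (Real.exp (κ * (n₀ + 1)) / κ) / √((t + 1 : ℕ) : ℝ) := by
  have hκ0 : 0 < κ := hκ ▸ one_sub_exp_div_pos hδ k.pos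
  set B : ℝ := Real.exp (κ * (n₀ + 1)) / κ / √((t + 1 : ℕ) : ℝ)
  have htail : ∀ i, ∀ l : ℝ, l ^ 2 = 16 * δ ^ 2 →
      P.real {ω | 1 ≤ tiltedWeight A Y i (μ i) l (4 * δ ^ 2) t ω} ≤ B := by
    intro i l hl
    -- For `l > 0` and `c = l δ`, the exponent `l² / 8 - l δ` is minimal at `l = 4 δ`, with value
    -- `-2 δ²`.
    have hq : l ^ 2 / 8 - 4 * δ ^ 2 = -(2 * δ ^ 2) := by rw [hl]; ring
    have hlc : l ^ 2 / 8 ≤ 4 * δ ^ 2 := by nlinarith [sq_nonneg δ]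
    have hE := h.lintegral_tiltedWeight_le hA hν i hlc (Nat.le_succ t)
    rw [hq, ← hκ] at hE
    refine ENNReal.toReal_le_of_le_ofReal (by positivity) ?_
    refine (meas_le_lintegral₀ (((hA.measurable_tiltedWeight i (μ i) l (4 * δ ^ 2) t).mono
      (ℱ.le t) le_rfl).aemeasurable) fun ω hω => hω).trans (hE.trans ?_)
    exact ENNReal.ofReal_le_ofReal (exp_neg_mul_div_sqrt_le hκ0 ht)
  have hsub : (G (t + 1) ⁻¹' {k})ᶜ ⊆
      ⋃ i, ({ω | 1 ≤ tiltedWeight A Y i (μ i) (4 * δ) (4 * δ ^ 2) t ω} ∪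
        {ω | 1 ≤ tiltedWeight A Y i (μ i) (-(4 * δ)) (4 * δ ^ 2) t ω}) := by
    intro ω hω
    by_contra hcon
    simp only [Set.mem_iUnion, Set.mem_union, Set.mem_ofPred_eq, not_exists, not_or, not_le] at hcon
    exact hω (h.greedy_eq hδ hΦ hμ ht fun i l hl => by
      rcases hl with rfl | rfl
      exacts [(hcon i).1, (hcon i).2])
  calc P.real (G (t + 1) ⁻¹' {k})ᶜ
      ≤ P.real _ := measureReal_mono hsub
    _ ≤ ∑ i, P.real _ := measureReal_iUnion_fintype_le _
    _ ≤ ∑ _i : Fin K, (B + B) := Finset.sum_le_sum fun i _ => (measureReal_union_le _ _).trans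
        (add_le_add (htail i _ (by ring)) (htail i _ (by ring)))
    _ = _ := by
        rw [Finset.sum_const, Finset.card_univ, Fintype.card_fin, nsmul_eq_mul]
        simp only [B]
        ring

/-- A suboptimal arm is played in round `t + 1` with probability `O(1 / √(t + 1))`. -/
theorem IsEpsGreedy.measureReal_arm_ne_le [IsProbabilityMeasure P] {δ : ℝ} (hδ : 0 < δ)
    (hA : IsBanditInteraction P ν ℱ A Y)
    (h : IsEpsGreedy P Φ (fun t => 1 / √(t : ℝ)) n₀ ℱ A Y θ G)
    (hν : IsSubgaussianBandit ν μ (1 / 2)) (hΦ : Φ.rank = d) {k : Fin K}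
    (hμ : cell μ δ ⊆ robustObservationRegion Φ k) {κ : ℝ}
    (hκ : κ = (1 - Real.exp (-(2 * δ ^ 2))) / K) (t : ℕ) :
    P.real (A (t + 1) ⁻¹' {k})ᶜ ≤
      (n₀ + 1 + 2 * K * (Real.exp (κ * (n₀ + 1)) / κ)) / √((t + 1 : ℕ) : ℝ) := by
  have hκ0 : 0 < κ := hκ ▸ one_sub_exp_div_pos hδ k.pos
  have hx1 : (1 : ℝ) ≤ √((t + 1 : ℕ) : ℝ) := Real.one_le_sqrt.mpr (by simp)
  rcases lt_or_ge t n₀ with hlt | hge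
  -- The summand `n₀` of the constant covers the initial rounds, where `√(t + 1) ≤ t + 1 ≤ n₀`.
  · refine measureReal_le_one.trans ((one_le_div (by linarith)).mpr ?_)
    have h1 : √((t + 1 : ℕ) : ℝ) ≤ ((t + 1 : ℕ) : ℝ) := by
      rw [Real.sqrt_le_left (by positivity)]
      exact le_self_pow₀ (by simp) two_ne_zero
    have h2 : ((t + 1 : ℕ) : ℝ) ≤ n₀ := mod_cast hlt
    have h3 : 0 ≤ 2 * K * (Real.exp (κ * (n₀ + 1)) / κ) := by positivity
    linarith
  · have hG := h.measureReal_greedy_ne_le hδ hA hν hΦ hμ hκ hge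
    have hGm : MeasurableSet (G (t + 1) ⁻¹' {k}) :=
      ℱ.le t _ (h.measurable_greedy t hge (measurableSet_singleton k))
    have hlaw := h.arm_law t hge Set.univ MeasurableSet.univ k
    have hε := one_div_sqrt_succ_le_one t
    simp only [Set.univ_inter, probReal_univ] at hlaw
    rw [probReal_compl_eq_one_sub hGm] at hG
    -- The arm law gives `P(A ≠ k) ≤ P(G ≠ k) + ε`; the summand `1` of the constant pays for `ε`.
    rw [probReal_compl_eq_one_sub (hA.measurableSet_arm t k), hlaw, add_div, add_div]
    set e := 1 / √((t + 1 : ℕ) : ℝ) with he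
    have he0 : 0 ≤ e := by positivity
    have h1 : 0 ≤ e * (1 / K) := by positivity
    have h2 : 0 ≤ (n₀ : ℝ) / √((t + 1 : ℕ) : ℝ) := by positivity
    have h3 : 0 ≤ e * (1 - P.real (G (t + 1) ⁻¹' {k})) :=
      mul_nonneg he0 (sub_nonneg.mpr measureReal_le_one)
    linarith

/-! ### Summation of the regret -/

theorem sum_Icc_one_div_sqrt_le (T : ℕ) :
    ∑ t ∈ Finset.Icc 1 T, 1 / √(t : ℝ) ≤ 2 * √(T : ℝ) := by
  induction T with
  | zero => simp
  | succ T ih =>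
    rw [Finset.sum_Icc_succ_top (by omega)]
    refine (add_le_add_left ih _).trans ?_
    have ha : 0 ≤ √(T : ℝ) := Real.sqrt_nonneg _
    have hb : 0 < √((T + 1 : ℕ) : ℝ) := by positivity
    have ha2 : √(T : ℝ) ^ 2 = T := Real.sq_sqrt (by positivity)
    have hb2 : √((T + 1 : ℕ) : ℝ) ^ 2 = T + 1 := by
      rw [Real.sq_sqrt (by positivity)]; push_cast; rfl
    set a := √(T : ℝ)
    set b := √((T + 1 : ℕ) : ℝ)
    rw [← sub_nonneg]
    -- This uses `b² - a² = 1`.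
    have : 2 * b - (2 * a + 1 / b) = (b - a) ^ 2 / b := by
      field_simp
      nlinarith
    rw [this]
    positivity

theorem maxGap_nonneg (μ : Fin K → ℝ) (k : Fin K) : 0 ≤ maxGap μ k := by
  have := Finset.le_sup' (fun i => μ k - μ i) (Finset.mem_univ k)
  exact (sub_self (μ k)).ge.trans this

/-- The expected regret is at most the maximal gap times the expected number of suboptimal plays. -/
theorem IsBanditInteraction.expectedRegret_le [IsProbabilityMeasure P]
    (hA : IsBanditInteraction P ν ℱ A Y) (μ : Fin K → ℝ) (k : Fin K) (T : ℕ) :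
    expectedRegret P μ k A T ≤
      maxGap μ k * ∑ t ∈ Finset.Icc 1 T, P.real (A t ⁻¹' {k})ᶜ := by
  have hmeas : ∀ t ∈ Finset.Icc 1 T, Measurable (A t) := fun t ht => by
    obtain ⟨r, rfl⟩ := Nat.exists_eq_add_of_le' (Finset.mem_Icc.mp ht).1
    exact (hA.measurable_arm r).mono (ℱ.le _) le_rfl
  have hint : ∀ t ∈ Finset.Icc 1 T, ∀ f : Fin K → ℝ, Integrable (fun ω => f (A t ω)) P :=
    fun t ht f =>
      have := Measure.isProbabilityMeasure_map (μ := P) (hmeas t ht).aemeasurable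
      (Integrable.of_finite (μ := P.map (A t)) (f := f)).comp_measurable (hmeas t ht)
  rw [expectedRegret, integral_finsetSum _ fun t ht => hint t ht fun i => μ k - μ i,
    Finset.mul_sum]
  refine Finset.sum_le_sum fun t ht => ?_
  have hE : MeasurableSet (A t ⁻¹' {k})ᶜ := (hmeas t ht (measurableSet_singleton k)).compl
  calc ∫ ω, (μ k - μ (A t ω)) ∂P
      ≤ ∫ ω, (A t ⁻¹' {k})ᶜ.indicator (fun _ => maxGap μ k) ω ∂P := by
        refine integral_mono (hint t ht fun i => μ k - μ i)
          ((integrable_const _).indicator hE) fun ω => ?_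
        by_cases hω : A t ω = k
        · simp [hω]
        · rw [Set.indicator_of_mem (by simpa using hω)]
          exact Finset.le_sup' (fun i => μ k - μ i) (Finset.mem_univ (A t ω))
    _ = _ := by rw [integral_indicator_const _ hE, smul_eq_mul, mul_comm]

end EpsGreedy

/-- The constant `C` depends only on the number of arms `K`, on the size `δ` of a cell around the
mean vector inside the robust observation region, and on the length `n₀` of the initial phase. -/
theorem mainTheorem2 (K n₀ : ℕ) (δ : ℝ) (hδ : 0 < δ) :
    ∃ C : ℝ, ∀ (d : ℕ) (Φ : Matrix (Fin K) (Fin d) ℝ), d < K → Φ.rank = d →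
      ∀ (k : Fin K) (μ : Fin K → ℝ), cell μ δ ⊆ robustObservationRegion Φ k →
      ∀ ν : Fin K → Measure ℝ, IsSubgaussianBandit ν μ (1 / 2) →
      ∀ (Ω : Type*) (mΩ : MeasurableSpace Ω) (P : Measure Ω), IsProbabilityMeasure P →
      ∀ (ℱ : Filtration ℕ mΩ) (A : ℕ → Ω → Fin K) (Y : ℕ → Ω → ℝ)
        (θ : ℕ → Ω → Fin d → ℝ) (G : ℕ → Ω → Fin K),
        IsBanditInteraction P ν ℱ A Y →
        IsEpsGreedy P Φ (fun t => 1 / √(t : ℝ)) n₀ ℱ A Y θ G →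
        ∀ T : ℕ, expectedRegret P μ k A T ≤ C * (maxGap μ k * √(T : ℝ)) := by
  set κ : ℝ := (1 - Real.exp (-(2 * δ ^ 2))) / K with hκ
  -- The final factor `2` comes from `∑ 1 / √t ≤ 2 √T`. For `K = 0` the divisions by zero are
  -- harmless, as there is no arm `k`.
  refine ⟨(n₀ + 1 + 2 * K * (Real.exp (κ * (n₀ + 1)) / κ)) * 2, ?_⟩
  intro d Φ _ hΦ k μ hμ ν hν Ω mΩ P _ ℱ A Y θ G hA hG T
  refine (hA.expectedRegret_le μ k T).trans ?_
  set D : ℝ := n₀ + 1 + 2 * K * (Real.exp (κ * (n₀ + 1)) / κ) with hD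
  have hround : ∀ t ∈ Finset.Icc 1 T, P.real (A t ⁻¹' {k})ᶜ ≤ D * (1 / √(t : ℝ)) := fun t ht => by
    obtain ⟨r, rfl⟩ := Nat.exists_eq_add_of_le' (Finset.mem_Icc.mp ht).1
    rw [mul_one_div]
    exact hG.measureReal_arm_ne_le hδ hA hν hΦ hμ hκ r
  have hκ0 : 0 < κ := hκ ▸ one_sub_exp_div_pos hδ k.pos
  have hD0 : 0 ≤ D := by positivity
  have hsum : ∑ t ∈ Finset.Icc 1 T, P.real (A t ⁻¹' {k})ᶜ ≤ D * (2 * √(T : ℝ)) := by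
    refine (Finset.sum_le_sum hround).trans ?_
    rw [← Finset.mul_sum]
    exact mul_le_mul_of_nonneg_left (sum_Icc_one_div_sqrt_le T) hD0
  calc _ ≤ maxGap μ k * (D * (2 * √(T : ℝ))) :=
        mul_le_mul_of_nonneg_left hsum (maxGap_nonneg μ k)
    _ = _ := by ring
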